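/- Let $V$ be a countable set, $E:V\times V\to[0,\infty)$ symmetric and $m:V\to(0,\infty)$. Call $x,y$ neighbours if $E(x,y)>0$; assume that every vertex has finitely many neighbours and that every connected component is infinite. For $f:V\to\mathbb{C}$ put $$\tilde\Delta_m f(x)=\frac1{m(x)}\sum_{y\in V}E(x,y)\,(f(x)-f(y)),$$ and let $\Delta_m$ be the self-adjoint operator on $\ell^2(V,m)$ which is the Friedrichs extension of the restriction of $\tilde\Delta_m$ to the finitely supported functions; $\sigma_{\rm ess}(\Delta_m)$ is its essential spectrum. Let $(S_n)_{n\ge0}$ be a 1-dimensional decomposition, i.e. a partition of $V$ into finite sets such that $E(x,y)>0$ with $x\in S_n$, $y\in S_k$ implies $|n-k|\le1$. Write $|x|=n$ for $x\in S_n$, $B_N=S_0\cup\dots\cup S_N$, and $$\deg_\pm(x)=\frac1{m(x)}\sum_{|y|=|x|\pm1}E(x,y)$$ (so $\deg_-(x)=0$ if $|x|=0$). Let $c>1$ be such that $$l:=\liminf_{|x|\to\infty}\bigl(\deg_+(x)-c\,\deg_-(x)\bigr)\in(0,\infty].$$ Let $n_0$ be the least $n\in\mathbb{N}$ such that $\deg_+(x)-c\deg_-(x)\ge0$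 for all $x$ with $|x|\ge n$, and set $$\phi_c(x)=\frac{c-1}{c}\bigl(\deg_+(x)-c\deg_-(x)\bigr)\mathbf 1_{V\setminus B_{n_0}}(x).$$ Then $\phi_c\ge0$, and the positive function $W$ given by $W(x)=c^{-n_0}$ for $x\in B_{n_0}$ and $W(x)=c^{-|x|}$ for $x\notin B_{n_0}$ satisfies $$\tilde\Delta_mW(x)\ge\phi_c(x)\,W(x)\qquad\text{for all }x\in V.$$ Moreover $\inf\sigma_{\rm ess}(\Delta_m)\ge l\,(c-1)/c$ (with $\inf\emptyset=+\infty$), and $\sigma_{\rm ess}(\Delta_m)=\emptyset$ if $l=\infty$. -/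

import Mathlib

open MeasureTheory Filter Topology
open scoped ENNReal

noncomputable section

/-- A weighted graph on the vertex set `V`: a symmetric non-negative edge weight `E`
(two vertices are neighbours when `E x y > 0`) and a positive vertex weight `m`, locally finite
and with all connected components infinite. -/
structure WGraph (V : Type*) where
  E : V → V → ℝ
  m : V → ℝ
  E_nonneg : ∀ x y, 0 ≤ E x y
  E_symm : ∀ x y, E x y = E y x
  m_pos : ∀ x, 0 < m x
  locallyFinite : ∀ x, {y | 0 < E x y}.Finite
  component_infinite : ∀ x, {y | Relation.ReflTransGen (fun a b => 0 < E a b) x y}.Infinite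

/-- A 1-dimensional decomposition `V = ⨆ Sₙ`, encoded by the function `x ↦ |x|`, where `|x|` is
the unique `n` with `x ∈ Sₙ = {x | |x| = n}`; each `Sₙ` is finite, and neighbours lie in the same
or in consecutive `Sₙ`. -/
structure OneDimDecomposition {V : Type*} (G : WGraph V) where
  level : V → ℕ
  sphere_finite : ∀ n, {x | level x = n}.Finite
  level_le : ∀ x y, 0 < G.E x y → level x ≤ level y + 1 ∧ level y ≤ level x + 1

namespace WGraph

variable {V : Type*} (G : WGraph V)

/-- The finite set of neighbours of `x`. -/
def nbrs (x : V) : Finset V := (G.locallyFinite x).toFinset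

theorem mem_nbrs {x y : V} : y ∈ G.nbrs x ↔ 0 < G.E x y := by
  simp [nbrs]

/-- The algebraic Laplacian
`(Δ̃ f)(x) = (1 / m(x)) ∑_y E(x,y) (f(x) - f(y))`, for functions with values in `ℝ` or `ℂ`.
Only neighbours `y` of `x` contribute to the sum. -/
def formalLaplacian {F : Type*} [AddCommGroup F] [Module ℝ F] (f : V → F) (x : V) : F :=
  (G.m x)⁻¹ • ∑ y ∈ G.nbrs x, G.E x y • (f x - f y)

/-- The weight `m` as a measure on `V`. -/
def measure [MeasurableSpace V] : Measure V :=
  Measure.sum fun x => ENNReal.ofReal (G.m x) • Measure.dirac x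

/-- The complex Hilbert space `ℓ²(V, m)`. -/
abbrev L2 [MeasurableSpace V] : Type _ := Lp ℂ 2 G.measure

section Measure

variable [MeasurableSpace V] [DiscreteMeasurableSpace V]

theorem measure_singleton (x : V) : G.measure {x} = ENNReal.ofReal (G.m x) := by
  classical
  rw [measure, Measure.sum_apply _ (MeasurableSet.of_discrete), tsum_eq_single x]
  · simp
  · intro y hy
    simp [hy]

theorem eq_of_ae {β : Type*} {f g : V → β} (h : f =ᵐ[G.measure] g) : f = g := by
  funext x
  by_contra hx
  have h0 : G.measure {x} = 0 := measure_mono_null (by simpa using hx) (ae_iff.mp h)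
  rw [measure_singleton, ENNReal.ofReal_eq_zero] at h0
  exact absurd (G.m_pos x) (not_lt.mpr h0)

theorem coe_add (f g : G.L2) : ⇑(f + g) = ⇑f + ⇑g := G.eq_of_ae (Lp.coeFn_add f g)

theorem coe_sub (f g : G.L2) : ⇑(f - g) = ⇑f - ⇑g := G.eq_of_ae (Lp.coeFn_sub f g)

theorem coe_smul (c : ℂ) (f : G.L2) : ⇑(c • f) = c • ⇑f := G.eq_of_ae (Lp.coeFn_smul c f)

theorem coe_zero : ⇑(0 : G.L2) = 0 := G.eq_of_ae (Lp.coeFn_zero ℂ 2 G.measure)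

theorem memLp_of_finite_support [Countable V] {f : V → ℂ} (hf : (Function.support f).Finite) :
    MemLp f 2 G.measure := by
  classical
  have hsum : f = ∑ x ∈ hf.toFinset, Set.indicator {x} (fun _ => f x) := by
    funext y
    rw [Finset.sum_apply]
    by_cases hy : f y = 0
    · rw [Finset.sum_eq_zero, hy]
      intro x hx
      by_cases hxy : y = x
      · subst hxy
        simp [hy]
      · simp [hxy]
    · rw [Finset.sum_eq_single y]
      · simp
      · intro x _ hxy
        simp [Ne.symm hxy]
      · intro h
        simp [hy] at h
  rw [hsum]
  refine memLp_finsetSum' _ fun x _ => ?_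
  exact memLp_indicator_const 2 (MeasurableSet.of_discrete) _
    (Or.inr (by rw [measure_singleton]; exact ENNReal.ofReal_ne_top))

end Measure

theorem formalLaplacian_add (f g : V → ℂ) :
    G.formalLaplacian (f + g) = G.formalLaplacian f + G.formalLaplacian g := by
  funext x
  simp only [formalLaplacian, Pi.add_apply, ← smul_add, ← Finset.sum_add_distrib]
  congr 1
  refine Finset.sum_congr rfl fun y _ => ?_
  congr 1
  ring

theorem formalLaplacian_smul (c : ℂ) (f : V → ℂ) :
    G.formalLaplacian (c • f) = c • G.formalLaplacian f := by
  funext x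
  simp only [formalLaplacian, Pi.smul_apply, ← smul_sub]
  rw [smul_comm c]
  congr 1
  rw [Finset.smul_sum]
  exact Finset.sum_congr rfl fun y _ => smul_comm (G.E x y) c (f x - f y)

theorem formalLaplacian_support {f : V → ℂ} (hf : (Function.support f).Finite) :
    (Function.support (G.formalLaplacian f)).Finite := by
  refine (hf.union (hf.biUnion fun y _ => (G.nbrs y).finite_toSet)).subset ?_
  intro x hx
  by_contra hcon
  simp only [Set.mem_union, Set.mem_iUnion, not_or, not_exists, Function.mem_support,
    not_not, Finset.mem_coe, G.mem_nbrs] at hcon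
  apply hx
  simp only [formalLaplacian]
  rw [Finset.sum_eq_zero, smul_zero]
  intro y hy
  have hy' : f y = 0 := by
    by_contra h
    exact hcon.2 y h (by rw [G.E_symm]; exact G.mem_nbrs.mp hy)
  rw [hcon.1, hy', sub_zero, smul_zero]

/-- The quadratic form `Q(f,f) = 1/2 ∑_x ∑_y E(x,y) |f(x) - f(y)|²`, with values in `[0,∞]`
(it is finite on `C_c(V)`). -/
def energy (f : V → ℂ) : ℝ≥0∞ :=
  2⁻¹ * ∑' x, ∑' y, ENNReal.ofReal (G.E x y * ‖f x - f y‖ ^ 2)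

theorem energy_smul (c : ℂ) (f : V → ℂ) :
    G.energy (c • f) = ENNReal.ofReal (‖c‖ ^ 2) * G.energy f := by
  simp only [energy]
  rw [mul_left_comm (ENNReal.ofReal (‖c‖ ^ 2))]
  congr 1
  rw [← ENNReal.tsum_mul_left]
  refine tsum_congr fun x => ?_
  rw [← ENNReal.tsum_mul_left]
  refine tsum_congr fun y => ?_
  rw [← ENNReal.ofReal_mul (by positivity), Pi.smul_apply, Pi.smul_apply, ← smul_sub, norm_smul]
  congr 1
  ring

theorem energy_add_le (f g : V → ℂ) :
    G.energy (f + g) ≤ 2 * G.energy f + 2 * G.energy g := by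
  simp only [energy]
  rw [mul_left_comm 2, mul_left_comm 2, ← mul_add]
  gcongr
  rw [← ENNReal.tsum_mul_left, ← ENNReal.tsum_mul_left, ← ENNReal.tsum_add]
  refine ENNReal.tsum_le_tsum fun x => ?_
  rw [← ENNReal.tsum_mul_left, ← ENNReal.tsum_mul_left, ← ENNReal.tsum_add]
  refine ENNReal.tsum_le_tsum fun y => ?_
  have hE := G.E_nonneg x y
  have h2 : (2 : ℝ≥0∞) = ENNReal.ofReal 2 := by simp
  rw [h2, ← ENNReal.ofReal_mul (by norm_num), ← ENNReal.ofReal_mul (by norm_num),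
    ← ENNReal.ofReal_add (by positivity) (by positivity)]
  apply ENNReal.ofReal_le_ofReal
  have h : ‖(f + g) x - (f + g) y‖ ≤ ‖f x - f y‖ + ‖g x - g y‖ := by
    have : (f + g) x - (f + g) y = (f x - f y) + (g x - g y) := by
      simp only [Pi.add_apply]
      ring
    rw [this]
    exact norm_add_le _ _
  have h3 : ‖(f + g) x - (f + g) y‖ ^ 2 ≤ 2 * ‖f x - f y‖ ^ 2 + 2 * ‖g x - g y‖ ^ 2 := by
    nlinarith [norm_nonneg ((f + g) x - (f + g) y), sq_nonneg (‖f x - f y‖ - ‖g x - g y‖)]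
  nlinarith [mul_le_mul_of_nonneg_left h3 hE]

section Operator

variable [Countable V] [MeasurableSpace V] [DiscreteMeasurableSpace V]

/-- `C_c(V)`: the finitely supported functions, as a subspace of `ℓ²(V, m)`. -/
def Cc : Submodule ℂ G.L2 where
  carrier := {f | (Function.support (f : V → ℂ)).Finite}
  zero_mem' := by
    rw [Set.mem_ofPred_eq, G.coe_zero, Function.support_zero]
    exact Set.finite_empty
  add_mem' := by
    intro f g hf hg
    simp only [Set.mem_ofPred_eq, G.coe_add] at *
    exact (hf.union hg).subset (Function.support_add _ _)
  smul_mem' := by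
    intro c f hf
    simp only [Set.mem_ofPred_eq, G.coe_smul] at *
    exact hf.subset (Function.support_const_smul_subset _ _)

/-- The Laplacian restricted to `C_c(V)`, as a densely defined operator on `ℓ²(V, m)`. -/
def minLaplacian : G.L2 →ₗ.[ℂ] G.L2 where
  domain := G.Cc
  toFun :=
    { toFun := fun f => (G.memLp_of_finite_support (G.formalLaplacian_support f.2)).toLp
      map_add' := by
        intro f g
        rw [← MemLp.toLp_add]
        exact MemLp.toLp_congr _ _
          (by rw [Submodule.coe_add, G.coe_add, G.formalLaplacian_add])
      map_smul' := by
        intro c f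
        rw [RingHom.id_apply, ← MemLp.toLp_const_smul]
        exact MemLp.toLp_congr _ _
          (by rw [Submodule.coe_smul, G.coe_smul, G.formalLaplacian_smul]) }

/-- The form domain: the completion of `C_c(V)` for the norm `‖f‖ + Q(f,f)^{1/2}`, realized in
`ℓ²(V, m)` as the set of the limits of those sequences of `C_c(V)` that converge in `ℓ²(V, m)` and
are Cauchy with respect to `Q`. -/
def formDomain : Submodule ℂ G.L2 where
  carrier := {f | ∃ u : ℕ → G.L2, (∀ n, u n ∈ G.Cc) ∧ Tendsto u atTop (𝓝 f) ∧
    Tendsto (fun p : ℕ × ℕ => G.energy (u p.1 - u p.2 : G.L2)) atTop (𝓝 0)}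
  zero_mem' := ⟨fun _ => 0, fun _ => G.Cc.zero_mem, tendsto_const_nhds, by
    simp only [sub_zero, G.coe_zero]
    simp [energy]⟩
  add_mem' := by
    rintro f g ⟨u, hu, huf, huQ⟩ ⟨v, hv, hvg, hvQ⟩
    refine ⟨u + v, fun n => G.Cc.add_mem (hu n) (hv n), huf.add hvg, ?_⟩
    have h2 : Tendsto (fun p : ℕ × ℕ => 2 * G.energy (u p.1 - u p.2 : G.L2)
        + 2 * G.energy (v p.1 - v p.2 : G.L2)) atTop (𝓝 0) := by
      have := (ENNReal.Tendsto.const_mul (a := 2) huQ (Or.inr (by simp))).add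
        (ENNReal.Tendsto.const_mul (a := 2) hvQ (Or.inr (by simp)))
      simpa using this
    refine tendsto_of_tendsto_of_tendsto_of_le_of_le tendsto_const_nhds h2
      (fun _ => zero_le) fun p => ?_
    have hp : (u + v) p.1 - (u + v) p.2 = (u p.1 - u p.2) + (v p.1 - v p.2) := by
      simp only [Pi.add_apply]
      abel
    simp only [hp, G.coe_add (u p.1 - u p.2)]
    exact G.energy_add_le _ _
  smul_mem' := by
    rintro c f ⟨u, hu, huf, huQ⟩
    refine ⟨c • u, fun n => G.Cc.smul_mem c (hu n), huf.const_smul c, ?_⟩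
    have h2 := ENNReal.Tendsto.const_mul (a := ENNReal.ofReal (‖c‖ ^ 2)) huQ
      (Or.inr ENNReal.ofReal_ne_top)
    rw [mul_zero] at h2
    refine h2.congr fun p => ?_
    rw [← G.energy_smul, ← G.coe_smul, smul_sub]
    rfl

/-- The Laplacian `Δ_m`: the Friedrichs extension of its restriction to `C_c(V)`, that is, the
restriction of the adjoint of the latter to the form domain. -/
def laplacian : G.L2 →ₗ.[ℂ] G.L2 :=
  G.minLaplacian.adjoint.domRestrict G.formDomain

end Operator

end WGraph

/-- `z` belongs to the resolvent set of the (unbounded) operator `A`: the map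
`A - z : D(A) → H` is bijective with a bounded inverse. -/
def InResolventSet {H : Type*} [NormedAddCommGroup H] [InnerProductSpace ℂ H]
    (A : H →ₗ.[ℂ] H) (z : ℂ) : Prop :=
  ∃ R : H →L[ℂ] H, (∀ h : H, ∃ hR : R h ∈ A.domain, A ⟨R h, hR⟩ - z • R h = h) ∧
    ∀ u : A.domain, R (A u - z • (u : H)) = u

/-- The spectrum of an unbounded operator. -/
def opSpectrum {H : Type*} [NormedAddCommGroup H] [InnerProductSpace ℂ H]
    (A : H →ₗ.[ℂ] H) : Set ℂ :=
  {z | ¬ InResolventSet A z}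

/-- The eigenspace `ker (A - z)`, as a subspace of the domain of `A`. -/
def opEigenspace {H : Type*} [NormedAddCommGroup H] [InnerProductSpace ℂ H]
    (A : H →ₗ.[ℂ] H) (z : ℂ) : Submodule ℂ A.domain :=
  LinearMap.ker (A.toFun - z • A.domain.subtype)

/-- The discrete spectrum of a self-adjoint operator: the isolated points of the spectrum that are
eigenvalues of finite multiplicity. -/
def discreteSpectrum {H : Type*} [NormedAddCommGroup H] [InnerProductSpace ℂ H]
    (A : H →ₗ.[ℂ] H) : Set ℂ :=
  {z ∈ opSpectrum A | (∀ᶠ w in 𝓝[≠] z, w ∉ opSpectrum A) ∧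
    opEigenspace A z ≠ ⊥ ∧ FiniteDimensional ℂ (opEigenspace A z)}

/-- The essential spectrum of a self-adjoint operator. -/
def essentialSpectrum {H : Type*} [NormedAddCommGroup H] [InnerProductSpace ℂ H]
    (A : H →ₗ.[ℂ] H) : Set ℂ :=
  opSpectrum A \ discreteSpectrum A

namespace OneDimDecomposition

variable {V : Type*} {G : WGraph V} (S : OneDimDecomposition G)

/-- The filter `|x| → ∞`. -/
def atInfinity : Filter V := comap S.level atTop

/-- The ball `B_N = S_0 ∪ ... ∪ S_N`. -/
def ball (N : ℕ) : Set V := {x | S.level x ≤ N}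

/-- The weighted outer degree `deg_+(x) = (1 / m(x)) ∑_{|y| = |x| + 1} E(x,y)`. -/
def degPlus (x : V) : ℝ :=
  (∑ y ∈ G.nbrs x with S.level y = S.level x + 1, G.E x y) / G.m x

/-- The weighted inner degree `deg_-(x) = (1 / m(x)) ∑_{|y| = |x| - 1} E(x,y)`, which is `0` when
`|x| = 0`. -/
def degMinus (x : V) : ℝ :=
  (∑ y ∈ G.nbrs x with S.level y + 1 = S.level x, G.E x y) / G.m x

/-- `l = liminf_{|x| → ∞} (deg_+(x) - c deg_-(x))`, an extended real number. -/
def lowerLimit (c : ℝ) : EReal :=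
  liminf (fun x => ((S.degPlus x - c * S.degMinus x : ℝ) : EReal)) S.atInfinity

/-- `n₀`, the least `n` such that `deg_+(x) - c deg_-(x) ≥ 0` whenever `|x| ≥ n`. -/
def radius (c : ℝ) : ℕ :=
  sInf {n : ℕ | ∀ x, n ≤ S.level x → 0 ≤ S.degPlus x - c * S.degMinus x}

/-- `φ_c = ((c - 1) / c) (deg_+ - c deg_-) 1_{V \ B_{n₀}}`. -/
def potential (c : ℝ) : V → ℝ :=
  (S.ball (S.radius c))ᶜ.indicator
    fun x => (c - 1) / c * (S.degPlus x - c * S.degMinus x)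

end OneDimDecomposition

end

/-! The supersolution is `W = c ^ (-max(|x|, n₀))`. A step outwards divides it by `c`, a step
inwards multiplies it by `c`, and it is maximal on the ball; so `Δ̃W` equals `φ_c W` off `B_{n₀}`
and is non-negative on it (`formalLaplacian_expWeight`, `formalLaplacian_expWeight_nonneg`).

The spectral bound is a Persson-type argument. The arithmetic-geometric inequality on each edge
gives the Hardy inequality `∑ m |f|² Δ̃W / W ≤ Q(f,f)` on `C_c(V)` (`sum_le_sum_norm_gradFun`). If
`0 < r < l`, then `Δ̃W ≥ s W` off a finite set `X`, where `s = r (c - 1) / c`; hence `Q(f,f) + ‖f‖²`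
dominates `(1 + s) ‖f‖²` up to a finite sum over `X` (`norm_sq_formEmbedding_le`).

To reach the operator, the form domain is realised as the closure of the graph of the gradient. If
`J` is its embedding into `ℓ²(V, m)`, then `R = J J*` is `(Δ_m + 1)⁻¹` (`laplacian_resolvent`,
`resolvent_laplacian`), and the Hardy inequality becomes `(1 + s) ‖R h‖ ≤ ‖h‖` whenever `R h`
vanishes on `X`, a condition of finite codimension. Spectral values of `R` above `(1 + s)⁻¹` are
therefore isolated eigenvalues of finite multiplicity (`IsSelfAdjoint.isolated_eigenvalue`), so
spectral points of `Δ_m` below `s` are discrete (`mem_essentialSpectrum_of_resolvent`). Finally `r`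
is arbitrary below `l`. -/

noncomputable section

/-! ### Isolated eigenvalues of bounded self-adjoint operators -/

section BoundedOperator

variable {H : Type*} [NormedAddCommGroup H] [InnerProductSpace ℂ H]

/-- The bound gives injectivity and closed range; by normality the orthogonal complement of the
range is the kernel, which is trivial, so the range is also dense. -/
theorem ContinuousLinearMap.isUnit_of_normal_of_bound [CompleteSpace H] {f : H →L[ℂ] H}
    (hf : IsStarNormal f) {k : ℝ} (hk : 0 < k) (h : ∀ x, k * ‖x‖ ≤ ‖f x‖) : IsUnit f := by
  have hb : ∀ x, ‖x‖ ≤ (⟨k⁻¹, by positivity⟩ : NNReal) * ‖f x‖ := fun x => by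
    have := mul_le_mul_of_nonneg_left (h x) (inv_nonneg.mpr hk.le)
    rwa [inv_mul_cancel_left₀ hk.ne'] at this
  rw [ContinuousLinearMap.isUnit_iff_bijective,
    ContinuousLinearMap.bijective_iff_dense_range_and_antilipschitz]
  refine ⟨?_, _, f.antilipschitz_of_bound hb⟩
  rw [Submodule.topologicalClosure_eq_top_iff, ContinuousLinearMap.IsStarNormal.orthogonal_range hf,
    Submodule.eq_bot_iff]
  intro x hx
  have h0 := h x
  rw [show f x = 0 from hx, norm_zero] at h0
  exact norm_le_zero_iff.mp (nonpos_of_mul_nonpos_right h0 hk)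

theorem IsSelfAdjoint.isStarNormal_sub_algebraMap [CompleteSpace H] {T : H →L[ℂ] H}
    (hT : IsSelfAdjoint T) (w : ℂ) : IsStarNormal (T - algebraMap ℂ (H →L[ℂ] H) w) := by
  refine ⟨?_⟩
  rw [star_sub, hT.star_eq, ← algebraMap_star_comm]
  exact ((Commute.refl T).sub_left (Algebra.commute_algebraMap_left _ _)).sub_right
    ((Algebra.commute_algebraMap_right _ _).sub_left (Algebra.commute_algebraMap_left _ _))

/-- The operator `T - μ`, for `T` self-adjoint and `μ` real, is either invertible or `μ` is an
isolated eigenvalue of finite multiplicity, provided that `T - μ` is bounded below on the kernel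
of a continuous linear map of finite rank. -/
theorem IsSelfAdjoint.isolated_eigenvalue [CompleteSpace H] {F : Type*} [NormedAddCommGroup F]
    [NormedSpace ℂ F] [FiniteDimensional ℂ F] {T : H →L[ℂ] H} (hT : IsSelfAdjoint T) (μ : ℝ)
    (g : H →L[ℂ] F) {δ : ℝ} (hδ : 0 < δ) (hg : ∀ x, g x = 0 → δ * ‖x‖ ≤ ‖T x - (μ : ℂ) • x‖)
    (hμ : ¬ IsUnit (T - algebraMap ℂ (H →L[ℂ] H) μ)) :
    (∃ x, x ≠ 0 ∧ T x = (μ : ℂ) • x) ∧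
    FiniteDimensional ℂ (T - algebraMap ℂ (H →L[ℂ] H) μ).ker ∧
    ∀ᶠ w : ℂ in 𝓝[≠] (μ : ℂ), IsUnit (T - algebraMap ℂ (H →L[ℂ] H) w) := by
  set S := T - algebraMap ℂ (H →L[ℂ] H) μ with hS
  have hSx : ∀ x, S x = T x - (μ : ℂ) • x := fun x => by
    simp [hS, Algebra.algebraMap_eq_smul_one]
  have hSsa : IsSelfAdjoint S := by
    refine hT.sub ?_
    rw [isSelfAdjoint_iff, ← algebraMap_star_comm]
    simp
  set Z := S.ker with hZ
  have hZc : IsClosed (Z : Set H) := S.isClosed_ker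
  have : CompleteSpace Z := hZc.completeSpace_coe
  have hfin : FiniteDimensional ℂ Z := by
    refine FiniteDimensional.of_injective ((g : H →ₗ[ℂ] F).comp Z.subtype) ?_
    rw [← LinearMap.ker_eq_bot, LinearMap.ker_eq_bot']
    intro x hx
    have h1 := hg x hx
    rw [← hSx, show S x = 0 from x.2, norm_zero] at h1
    exact Subtype.ext (norm_le_zero_iff.mp (nonpos_of_mul_nonpos_right h1 hδ))
  -- the range of `S` is closed
  have hrange : IsClosed (S.range : Set H) := by
    have : (g.ker : Submodule ℂ H).CoFG := Submodule.CoFG.ker _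
    -- `S` is bounded below on `ker g`, so the image of `ker g` is closed; the full range exceeds it
    -- by finitely many dimensions.
    refine LinearMap.isClosed_range_of_isClosed_map_of_finiteDimensional_quotient
      (s := g.ker) ?_
    have : CompleteSpace g.ker := g.isClosed_ker.completeSpace_coe
    have hb : ∀ x : g.ker, ‖x‖ ≤ (⟨δ⁻¹, by positivity⟩ : NNReal) * ‖(S.comp g.ker.subtypeL) x‖ := by
      intro x
      have := mul_le_mul_of_nonneg_left (hg x x.2) (inv_nonneg.mpr hδ.le)
      rw [inv_mul_cancel_left₀ hδ.ne', ← hSx] at this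
      exact this
    have := ((S.comp g.ker.subtypeL).antilipschitz_of_bound hb).isClosed_range
      (S.comp g.ker.subtypeL).uniformContinuous
    convert this using 1
    ext y
    simp
  -- `S` is bounded below on the orthogonal complement of its kernel
  obtain ⟨k, hk, hbelow⟩ : ∃ k : ℝ, 0 < k ∧ ∀ y ∈ Zᗮ, k * ‖y‖ ≤ ‖S y‖ := by
    set f := S.comp Zᗮ.subtypeL with hf
    have hinj : Function.Injective f := by
      rw [injective_iff_map_eq_zero]
      intro y hy
      have h1 : (y : H) ∈ Z := hy
      exact Subtype.ext (inner_self_eq_zero.mp (y.2 _ h1))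
    have hr : Set.range f = (S.range : Set H) := by
      ext y
      constructor
      · rintro ⟨x, rfl⟩
        exact ⟨x, rfl⟩
      · rintro ⟨x, rfl⟩
        obtain ⟨a, ha, b, hb, rfl⟩ := Z.exists_add_mem_mem_orthogonal x
        refine ⟨⟨b, hb⟩, ?_⟩
        have : S a = 0 := ha
        simp [hf, this]
    obtain ⟨K, hK⟩ := f.antilipschitz_of_injective_of_isClosed_range hinj (hr ▸ hrange)
    -- The `+ 1` guards against `K = 0`.
    refine ⟨((K : ℝ) + 1)⁻¹, by positivity, fun y hy => ?_⟩
    have h1 := hK.le_mul_dist ⟨y, hy⟩ 0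
    simp only [dist_zero_right, map_zero] at h1
    rw [inv_mul_le_iff₀ (by positivity)]
    refine le_trans h1 ?_
    gcongr
    · simp
    · exact le_rfl
  refine ⟨?_, hfin, ?_⟩
  · by_contra! hcon
    refine hμ (ContinuousLinearMap.isUnit_of_normal_of_bound hSsa.isStarNormal hk fun x => ?_)
    refine hbelow x ?_
    have : Z = ⊥ := by
      rw [Submodule.eq_bot_iff]
      intro z hz
      by_contra hne
      exact hcon z hne (sub_eq_zero.mp ((hSx z).symm.trans hz))
    rw [this]
    simp
  -- Within `k / 2` of `μ`, the lower bound `k - ‖w - μ‖` of `T - w` on `Zᗮ` is at least `‖w - μ‖`,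
  -- the factor by which `T - w` scales norms on `Z`. Both subspaces are invariant, so `T - w` is
  -- bounded below by `‖w - μ‖`.
  · have hev : ∀ᶠ w : ℂ in 𝓝[≠] (μ : ℂ), w ≠ μ ∧ ‖w - μ‖ < k / 2 := by
      refine (eventually_mem_nhdsWithin (s := {(μ : ℂ)}ᶜ)).and ?_
      refine eventually_nhdsWithin_of_eventually_nhds ?_
      have := Metric.ball_mem_nhds (μ : ℂ) (half_pos hk)
      filter_upwards [this] with w hw
      rwa [← dist_eq_norm]
    filter_upwards [hev] with w ⟨hw1, hw2⟩
    have hw0 : 0 < ‖w - μ‖ := norm_pos_iff.mpr (sub_ne_zero.mpr hw1)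
    refine ContinuousLinearMap.isUnit_of_normal_of_bound (hT.isStarNormal_sub_algebraMap w) hw0
      fun x => ?_
    obtain ⟨a, ha, b, hb, rfl⟩ := Z.exists_add_mem_mem_orthogonal x
    have hSa : S a = 0 := ha
    have hSb : S b ∈ Zᗮ := fun z hz => by
      have hz0 : S z = 0 := hz
      rw [← ContinuousLinearMap.adjoint_inner_left, hSsa.adjoint_eq, hz0, inner_zero_left]
    have hTx : (T - algebraMap ℂ (H →L[ℂ] H) w) (a + b) = ((μ - w) • a) + (S b - (w - μ) • b) := by
      have h1 : (T - algebraMap ℂ (H →L[ℂ] H) w) (a + b) = S (a + b) - (w - μ) • (a + b) := by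
        have h0 : (T - algebraMap ℂ (H →L[ℂ] H) w) (a + b) = T (a + b) - w • (a + b) := by
          simp only [Algebra.algebraMap_eq_smul_one, sub_apply,
            smul_apply, one_apply_eq_self]
        rw [hSx, h0]
        module
      rw [h1, map_add, hSa]
      module
    have horth1 : inner ℂ a b = 0 := hb a ha
    have horth2 : inner ℂ ((μ - w) • a) (S b - (w - μ) • b) = 0 := by
      rw [inner_smul_left, inner_sub_right, inner_smul_right, hSb a ha, horth1]
      simp
    have hlow : ‖w - μ‖ * ‖b‖ ≤ ‖S b - (w - μ) • b‖ := by
      have h1 := norm_sub_norm_le (S b) ((w - μ) • b)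
      have h2 := hbelow b hb
      rw [norm_smul] at h1
      nlinarith [norm_nonneg b]
    have e1 := norm_add_sq_eq_norm_sq_add_norm_sq_of_inner_eq_zero a b horth1
    have e2 := norm_add_sq_eq_norm_sq_add_norm_sq_of_inner_eq_zero _ _ horth2
    rw [hTx]
    refine le_of_sq_le_sq ?_ (norm_nonneg _)
    rw [norm_smul, norm_sub_rev] at e2
    calc (‖w - μ‖ * ‖a + b‖) ^ 2
        = ‖w - μ‖ * ‖a‖ * (‖w - μ‖ * ‖a‖) + ‖w - μ‖ * ‖b‖ * (‖w - μ‖ * ‖b‖) := by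
          linear_combination ‖w - μ‖ ^ 2 * e1
      _ ≤ _ := by
          rw [sq, e2]
          gcongr

end BoundedOperator

end

/-! ### Essential spectrum of an unbounded operator through its resolvent at `-1` -/

noncomputable section

section UnboundedOperator

variable {H : Type*} [NormedAddCommGroup H] [InnerProductSpace ℂ H]

/-- `z ≠ -1` is in the resolvent set of `A` when `(A + 1)⁻¹ - (z + 1)⁻¹` is invertible. -/
theorem inResolventSet_of_isUnit {A : H →ₗ.[ℂ] H} {R : H →L[ℂ] H}
    (hR : ∀ h : H, ∃ hd : R h ∈ A.domain, A ⟨R h, hd⟩ + R h = h)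
    (hR' : ∀ u : A.domain, R (A u + u) = u) {z : ℂ} (hz : z + 1 ≠ 0)
    (hu : IsUnit (R - algebraMap ℂ (H →L[ℂ] H) (z + 1)⁻¹)) : InResolventSet A z := by
  obtain ⟨⟨f, g, hfg, hgf⟩, hf⟩ := hu
  have hfx : ∀ x, (-(z + 1)) • f x = x - (z + 1) • R x := fun x => by
    have : f x = R x - (z + 1)⁻¹ • x := by
      rw [show f = _ from hf]
      simp only [Algebra.algebraMap_eq_smul_one, sub_apply,
        smul_apply, one_apply_eq_self]
    rw [this, smul_sub, neg_smul, neg_smul, smul_inv_smul₀ hz]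
    abel
  have hz' : -(z + 1) ≠ 0 := neg_ne_zero.mpr hz
  have hfg' : ∀ x, f (g x) = x := fun x => DFunLike.congr_fun hfg x
  have hgf' : ∀ x, g (f x) = x := fun x => DFunLike.congr_fun hgf x
  -- With `f = R - (z + 1)⁻¹` and inverse `g`, one has `(A - z) R = 1 - (z + 1) R = -(z + 1) f`;
  -- hence this candidate for `(A - z)⁻¹`.
  refine ⟨R.comp ((-(z + 1))⁻¹ • g), fun h => ?_, fun u => ?_⟩
  · obtain ⟨hd, he⟩ := hR ((-(z + 1))⁻¹ • g h)
    refine ⟨hd, ?_⟩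
    have h1 := hfx ((-(z + 1))⁻¹ • g h)
    rw [map_smul, smul_inv_smul₀ hz', hfg'] at h1
    have h2 := eq_sub_of_add_eq he
    change A ⟨R ((-(z + 1))⁻¹ • g h), hd⟩ - z • R ((-(z + 1))⁻¹ • g h) = h
    rw [h2]
    conv_rhs => rw [h1]
    module
  · have h1 := hR' u
    have h2 : A u - z • (u : H) = (-(z + 1)) • f (A u + u) := by
      rw [hfx, h1]
      module
    change R ((-(z + 1))⁻¹ • g (A u - z • (u : H))) = u
    rw [h2, g.map_smul, inv_smul_smul₀ hz', hgf', h1]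

/-- A spectral point `t < s` of `A` corresponds to `μ = (t + 1)⁻¹ > (1 + s)⁻¹` in the spectrum of
`R`. On `ker g` the norm of `R` is at most `(1 + s)⁻¹`, so `R - μ` is bounded below there, and
`IsSelfAdjoint.isolated_eigenvalue` puts `t` in the discrete spectrum. -/
theorem mem_essentialSpectrum_of_resolvent [CompleteSpace H] {F : Type*} [NormedAddCommGroup F]
    [NormedSpace ℂ F] [FiniteDimensional ℂ F] {A : H →ₗ.[ℂ] H} {R : H →L[ℂ] H}
    (hpos : R.IsPositive)
    (hR : ∀ h : H, ∃ hd : R h ∈ A.domain, A ⟨R h, hd⟩ + R h = h)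
    (hR' : ∀ u : A.domain, R (A u + u) = u) {s : ℝ} (hs : 0 < s) (g : H →L[ℂ] F)
    (hg : ∀ h, g h = 0 → (1 + s) * ‖R h‖ ≤ ‖h‖) {z : ℂ} (hz : z ∈ essentialSpectrum A) :
    ∃ t : ℝ, z = t ∧ s ≤ t := by
  obtain ⟨hzs, hzd⟩ := hz
  have hsa : IsSelfAdjoint R := hpos.isSelfAdjoint
  have hz1 : z + 1 ≠ 0 := by
    intro h0
    have hz' : z = -1 := eq_neg_of_add_eq_zero_left h0
    refine hzs ⟨R, fun h => ?_, fun u => ?_⟩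
    · obtain ⟨hd, he⟩ := hR h
      exact ⟨hd, by rw [hz', neg_one_smul, sub_neg_eq_add, he]⟩
    · rw [hz', neg_one_smul, sub_neg_eq_add, hR']
  have hμ : ¬ IsUnit (R - algebraMap ℂ (H →L[ℂ] H) (z + 1)⁻¹) :=
    fun h => hzs (inResolventSet_of_isUnit hR hR' hz1 h)
  have hspec : (z + 1)⁻¹ ∈ spectrum ℂ R := by
    rw [spectrum.mem_iff]
    exact fun h => hμ (by simpa using h.neg)
  obtain ⟨t, rfl⟩ : ∃ t : ℝ, z = t := by
    have h1 := hsa.mem_spectrum_eq_re hspec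
    refine ⟨((z + 1)⁻¹).re⁻¹ - 1, ?_⟩
    push_cast
    rw [← h1]
    simp
  refine ⟨t, rfl, ?_⟩
  by_contra! hts
  -- Positivity of `R` excludes `t < -1`, where inversion would not send `t < s` to `(t + 1)⁻¹ > (1
  -- + s)⁻¹`.
  have hμ0 : 0 < t + 1 := by
    have h1 : (0 : ℝ) ≤ (t + 1)⁻¹ := by
      have : (0 : H →L[ℂ] H) ≤ R := (ContinuousLinearMap.nonneg_iff_isPositive R).mpr hpos
      refine spectrum_nonneg_of_nonneg this (spectrum.algebraMap_mem_iff ℂ |>.mp ?_)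
      simpa using hspec
    refine lt_of_le_of_ne (inv_nonneg.mp h1) fun h => hz1 ?_
    rw [← Complex.ofReal_one, ← Complex.ofReal_add, ← h, Complex.ofReal_zero]
  have hcast : ((t : ℂ) + 1)⁻¹ = (((t + 1)⁻¹ : ℝ) : ℂ) := by push_cast; rfl
  rw [hcast] at hμ
  have hδ : 0 < (t + 1)⁻¹ - (1 + s)⁻¹ := by
    rw [sub_pos]
    exact inv_strictAnti₀ hμ0 (by linarith)
  obtain ⟨⟨x, hx0, hx⟩, hfin, hiso⟩ := hsa.isolated_eigenvalue _ g hδ (fun x hx => by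
    have h1 := norm_sub_norm_le ((((t + 1)⁻¹ : ℝ) : ℂ) • x) (R x)
    rw [norm_smul, Complex.norm_real, Real.norm_of_nonneg (by positivity), norm_sub_rev] at h1
    have h2 : ‖R x‖ ≤ (1 + s)⁻¹ * ‖x‖ := by
      rw [le_inv_mul_iff₀ (by positivity)]
      exact hg x hx
    linarith) hμ
  have key : ∀ u : A.domain, A u = (t : ℂ) • (u : H) → R u = (((t + 1)⁻¹ : ℝ) : ℂ) • (u : H) := by
    intro u hu
    have h1 := hR' u
    rw [hu, map_add, map_smul] at h1
    rw [← hcast, eq_inv_smul_iff₀ hz1, add_smul, one_smul, h1]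
  refine hzd ⟨hzs, ?_, ?_, ?_⟩
  · have htend : Tendsto (fun w : ℂ => (w + 1)⁻¹) (𝓝[≠] (t : ℂ))
        (𝓝[≠] (((t + 1)⁻¹ : ℝ) : ℂ)) := by
      refine tendsto_nhdsWithin_iff.mpr ⟨?_, ?_⟩
      · rw [← hcast]
        exact (((continuous_id.add continuous_const).tendsto _).inv₀ hz1).mono_left
          nhdsWithin_le_nhds
      · filter_upwards [eventually_mem_nhdsWithin] with w hw h
        refine hw ?_
        rw [Set.mem_singleton_iff, ← hcast, inv_inj, add_left_inj] at h
        exact h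
    have hne : ∀ᶠ w : ℂ in 𝓝[≠] (t : ℂ), w + 1 ≠ 0 :=
      eventually_nhdsWithin_of_eventually_nhds
        ((continuous_id.add continuous_const).continuousAt.eventually_ne hz1)
    filter_upwards [htend.eventually hiso, hne] with w hw1 hw2
    exact fun h => h (inResolventSet_of_isUnit hR hR' hw2 hw1)
  · rw [Submodule.ne_bot_iff]
    have hxd : x ∈ A.domain := by
      have h1 : x = R ((t + 1 : ℂ) • x) := by
        rw [map_smul, hx, ← hcast, smul_inv_smul₀ hz1]
      rw [h1]
      exact (hR _).1
    refine ⟨⟨x, hxd⟩, ?_, fun h => hx0 (congrArg Subtype.val h)⟩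
    have h1 : x = R ((t + 1 : ℂ) • x) := by
      rw [map_smul, hx, ← hcast, smul_inv_smul₀ hz1]
    obtain ⟨hd, he⟩ := hR ((t + 1 : ℂ) • x)
    have h2 : A ⟨x, hxd⟩ + x = (t + 1 : ℂ) • x := by
      have : (⟨R ((t + 1 : ℂ) • x), hd⟩ : A.domain) = ⟨x, hxd⟩ := Subtype.ext h1.symm
      rwa [this, ← h1] at he
    rw [add_smul, one_smul, add_left_inj] at h2
    rw [opEigenspace, LinearMap.mem_ker]
    simpa [sub_eq_zero] using h2
  · refine FiniteDimensional.of_injective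
      (V₂ := (R - algebraMap ℂ (H →L[ℂ] H) (((t + 1)⁻¹ : ℝ) : ℂ)).ker)
      (((A.domain.subtype).comp (opEigenspace A t).subtype).codRestrict _ fun u => ?_) ?_
    · have hu' := LinearMap.mem_ker.mp u.2
      have := key u.1 (by simpa [sub_eq_zero] using hu')
      simp [Algebra.algebraMap_eq_smul_one] 
      rw [this]
      simp
    · intro u v huv
      have h := congrArg Subtype.val huv
      exact Subtype.ext (Subtype.ext h)

end UnboundedOperator

end

/-! ### Green's formula and the Hardy inequality as finite sums -/

noncomputable section

namespace WGraph

variable {V : Type*} (G : WGraph V)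

theorem E_eq_zero_of_notMem_nbrs {x y : V} (h : y ∉ G.nbrs x) : G.E x y = 0 :=
  le_antisymm (not_lt.mp fun h' => h (G.mem_nbrs.mpr h')) (G.E_nonneg x y)

/-- A sum over the neighbours of `x` may be taken over any finite set off which the terms vanish. -/
theorem sum_nbrs_eq {F : Type*} [AddCommGroup F] [Module ℝ F] (x : V) (X : Finset V) {g : V → F}
    (h : ∀ y ∈ G.nbrs x, y ∉ X → g y = 0) :
    ∑ y ∈ G.nbrs x, G.E x y • g y = ∑ y ∈ X, G.E x y • g y := by
  classical
  refine (Finset.sum_subset (Finset.subset_union_left (s₂ := X)) fun y _ hn => ?_).trans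
    (Finset.sum_subset (Finset.subset_union_right (s₁ := G.nbrs x)) fun y _ hyX => ?_).symm
  · rw [G.E_eq_zero_of_notMem_nbrs hn, zero_smul]
  · by_cases hn : y ∈ G.nbrs x
    · rw [h y hn hyX, smul_zero]
    · rw [G.E_eq_zero_of_notMem_nbrs hn, zero_smul]

/-- `X` contains the support of `f` together with its neighbours. -/
def IsNhdSupport (f : V → ℂ) (X : Finset V) : Prop :=
  ∀ x, f x ≠ 0 → x ∈ X ∧ G.nbrs x ⊆ X

theorem exists_isNhdSupport {f : V → ℂ} (hf : (Function.support f).Finite) :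
    ∃ X, G.IsNhdSupport f X := by
  classical
  refine ⟨hf.toFinset ∪ hf.toFinset.biUnion G.nbrs, fun x hx => ?_⟩
  have hx' : x ∈ hf.toFinset := by simpa using hx
  exact ⟨Finset.mem_union_left _ hx', (Finset.subset_biUnion_of_mem G.nbrs hx').trans
    Finset.subset_union_right⟩

variable {G} in
theorem IsNhdSupport.eq_zero {f : V → ℂ} {X : Finset V} (hX : G.IsNhdSupport f X) {x : V}
    (hx : x ∉ X) : f x = 0 := by
  by_contra h
  exact hx (hX x h).1

variable {G} in
theorem IsNhdSupport.eq_zero_of_nbr {f : V → ℂ} {X : Finset V} (hX : G.IsNhdSupport f X) {x y : V}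
    (hy : y ∈ G.nbrs x) (hyX : y ∉ X) : f x = 0 := by
  by_contra h
  exact hyX ((hX x h).2 hy)

/-- The discrete gradient of `f`, a function on pairs of vertices. -/
def gradFun (f : V → ℂ) (p : V × V) : ℂ := √(G.E p.1 p.2 / 2) • (f p.1 - f p.2)

theorem gradFun_eq_zero {f : V → ℂ} {X : Finset V} (hX : G.IsNhdSupport f X) {p : V × V}
    (hp : p ∉ X ×ˢ X) : G.gradFun f p = 0 := by
  rw [gradFun]
  by_cases hn : p.2 ∈ G.nbrs p.1
  · have hn' : p.1 ∈ G.nbrs p.2 := by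
      rw [mem_nbrs] at hn ⊢
      rwa [G.E_symm]
    have h0 : f p.1 = 0 ∧ f p.2 = 0 := by
      rw [Finset.mem_product, not_and_or] at hp
      rcases hp with hp | hp
      · exact ⟨hX.eq_zero hp, hX.eq_zero_of_nbr hn' hp⟩
      · exact ⟨hX.eq_zero_of_nbr hn hp, hX.eq_zero hp⟩
    rw [h0.1, h0.2, sub_zero, smul_zero]
  · rw [G.E_eq_zero_of_notMem_nbrs hn, zero_div, Real.sqrt_zero, zero_smul]

theorem norm_gradFun_sq (f : V → ℂ) (p : V × V) :
    ‖G.gradFun f p‖ ^ 2 = G.E p.1 p.2 / 2 * ‖f p.1 - f p.2‖ ^ 2 := by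
  rw [gradFun, norm_smul, mul_pow, Real.norm_of_nonneg (Real.sqrt_nonneg _),
    Real.sq_sqrt (by have := G.E_nonneg p.1 p.2; positivity)]

theorem inner_gradFun (f g : V → ℂ) (p : V × V) :
    inner ℂ (G.gradFun f p) (G.gradFun g p)
      = (G.E p.1 p.2 / 2) • inner ℂ (f p.1 - f p.2) (g p.1 - g p.2) := by
  rw [gradFun, gradFun, inner_smul_left_eq_smul, inner_smul_right_eq_smul, smul_smul,
    Real.mul_self_sqrt (by have := G.E_nonneg p.1 p.2; positivity)]

theorem energy_eq_tsum (f : V → ℂ) :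
    G.energy f = ∑' p : V × V, ENNReal.ofReal (‖G.gradFun f p‖ ^ 2) := by
  rw [ENNReal.tsum_prod', energy, ← ENNReal.tsum_mul_left]
  refine tsum_congr fun x => ?_
  rw [← ENNReal.tsum_mul_left]
  refine tsum_congr fun y => ?_
  have h2 : (2⁻¹ : ℝ≥0∞) = ENNReal.ofReal 2⁻¹ := by
    rw [ENNReal.ofReal_inv_of_pos two_pos]
    simp
  rw [norm_gradFun_sq, h2, ← ENNReal.ofReal_mul (by norm_num)]
  congr 1
  ring

/-- Green's formula, in terms of finite sums. -/
theorem sum_inner_gradFun (u f : V → ℂ) {X : Finset V} (hX : G.IsNhdSupport f X) :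
    ∑ p ∈ X ×ˢ X, inner ℂ (G.gradFun u p) (G.gradFun f p)
      = ∑ x ∈ X, (G.m x) • inner ℂ (u x) (G.formalLaplacian f x) := by
  have hR : ∀ x ∈ X, G.m x • inner ℂ (u x) (G.formalLaplacian f x)
      = ∑ y ∈ X, G.E x y • inner ℂ (u x) (f x - f y) := by
    intro x _
    rw [formalLaplacian, inner_smul_right_eq_smul, smul_inv_smul₀ (G.m_pos x).ne',
      G.sum_nbrs_eq x X, inner_sum]
    · simp only [inner_smul_right_eq_smul]
    · intro y hy hyX
      rw [hX.eq_zero hyX, hX.eq_zero_of_nbr hy hyX, sub_zero]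
  rw [Finset.sum_congr rfl hR, Finset.sum_product]
  set A := ∑ x ∈ X, ∑ y ∈ X, G.E x y • inner ℂ (u x) (f x - f y) with hA
  -- Averaging `A` with its image under the exchange of `x` and `y` produces the product of
  -- differences.
  have hA' : A = ∑ x ∈ X, ∑ y ∈ X, G.E x y • inner ℂ (u y) (f y - f x) := by
    rw [hA, Finset.sum_comm]
    refine Finset.sum_congr rfl fun x _ => Finset.sum_congr rfl fun y _ => ?_
    rw [G.E_symm]
  have h2 : A = (2 : ℝ)⁻¹ • (A + A) := by
    rw [← two_smul ℝ A, inv_smul_smul₀ two_ne_zero]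
  rw [h2]
  nth_rewrite 2 [hA']
  rw [hA, ← Finset.sum_add_distrib, Finset.smul_sum]
  refine Finset.sum_congr rfl fun x _ => ?_
  rw [← Finset.sum_add_distrib, Finset.smul_sum]
  refine Finset.sum_congr rfl fun y _ => ?_
  rw [inner_gradFun, ← smul_add, smul_smul]
  congr 1
  · ring
  · simp only [inner_sub_left, inner_sub_right]
    ring

/-- The cross term satisfies `2‖a‖‖b‖ ≤ ‖a‖² w / v + ‖b‖² v / w`. With `v = W x` and `w = W y` this
is the Hardy inequality on a single edge. -/
theorem norm_sub_sq_ge {a b : ℂ} {v w : ℝ} (hv : 0 < v) (hw : 0 < w) :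
    ‖a‖ ^ 2 * (1 - w / v) + ‖b‖ ^ 2 * (1 - v / w) ≤ ‖a - b‖ ^ 2 := by
  have h1 : (‖a‖ - ‖b‖) ^ 2 ≤ ‖a - b‖ ^ 2 := by
    have := abs_norm_sub_norm_le a b
    rw [← sq_abs]
    gcongr
  have h2 : ‖a‖ ^ 2 * (w / v) + ‖b‖ ^ 2 * (v / w) - 2 * ‖a‖ * ‖b‖
      = (‖a‖ * w - ‖b‖ * v) ^ 2 / (v * w) := by
    field_simp
    ring
  have h3 : 0 ≤ (‖a‖ * w - ‖b‖ * v) ^ 2 / (v * w) := by positivity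
  nlinarith

/-- The Hardy inequality for a positive function `W`, in terms of finite sums. -/
theorem sum_le_sum_norm_gradFun (f : V → ℂ) {X : Finset V} (hX : G.IsNhdSupport f X) {W : V → ℝ}
    (hW : ∀ x, 0 < W x) :
    ∑ x ∈ X, G.m x * (‖f x‖ ^ 2 * (G.formalLaplacian W x / W x))
      ≤ ∑ p ∈ X ×ˢ X, ‖G.gradFun f p‖ ^ 2 := by
  have hR : ∀ x ∈ X, G.m x * (‖f x‖ ^ 2 * (G.formalLaplacian W x / W x))
      = ∑ y ∈ X, G.E x y • (‖f x‖ ^ 2 * (1 - W y / W x)) := by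
    intro x _
    rw [← G.sum_nbrs_eq x X]
    · rw [formalLaplacian, smul_eq_mul]
      have h1 := (G.m_pos x).ne'
      have h2 := (hW x).ne'
      have : ∀ y, G.E x y • (‖f x‖ ^ 2 * (1 - W y / W x))
          = ‖f x‖ ^ 2 / W x * (G.E x y • (W x - W y)) := by
        intro y
        simp only [smul_eq_mul]
        field_simp
      simp only [this, ← Finset.mul_sum]
      field_simp
    · intro y hy hyX
      rw [hX.eq_zero_of_nbr hy hyX]
      simp
  rw [Finset.sum_congr rfl hR, Finset.sum_product]
  set A := ∑ x ∈ X, ∑ y ∈ X, G.E x y • (‖f x‖ ^ 2 * (1 - W y / W x)) with hA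
  have hA' : A = ∑ x ∈ X, ∑ y ∈ X, G.E x y • (‖f y‖ ^ 2 * (1 - W x / W y)) := by
    rw [hA, Finset.sum_comm]
    refine Finset.sum_congr rfl fun x _ => Finset.sum_congr rfl fun y _ => ?_
    rw [G.E_symm]
  have h2 : A = 2⁻¹ * (A + A) := by ring
  rw [h2]
  nth_rewrite 2 [hA']
  rw [hA, ← Finset.sum_add_distrib, Finset.mul_sum]
  refine Finset.sum_le_sum fun x _ => ?_
  rw [← Finset.sum_add_distrib, Finset.mul_sum]
  refine Finset.sum_le_sum fun y _ => ?_
  rw [norm_gradFun_sq]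
  have := mul_le_mul_of_nonneg_left (norm_sub_sq_ge (a := f x) (b := f y) (hW x) (hW y))
    (G.E_nonneg x y)
  simp only [smul_eq_mul]
  linarith

/-! ### Point evaluations and density of `C_c(V)` -/

section Measure

variable [MeasurableSpace V] [DiscreteMeasurableSpace V]

theorem inner_eq_sum (f g : G.L2) (s : Finset V) (h : ∀ x ∉ s, inner ℂ (f x) (g x) = 0) :
    inner ℂ f g = ∑ x ∈ s, G.m x • inner ℂ (f x) (g x) := by
  rw [L2.inner_def, ← setIntegral_eq_integral_of_forall_compl_eq_zero (s := (s : Set V)) h,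
    setIntegral_finset]
  · refine Finset.sum_congr rfl fun x _ => ?_
    rw [Measure.real, measure_singleton, ENNReal.toReal_ofReal (G.m_pos x).le]
  · exact (L2.integrable_inner f g).integrableOn

variable [Countable V]

/-- The indicator function of `{x}`, as an element of `ℓ²(V, m)`. -/
def single (x : V) : G.L2 :=
  (G.memLp_of_finite_support (f := Set.indicator {x} 1)
    ((Set.finite_singleton x).subset Set.support_indicator_subset)).toLp

theorem coe_single (x : V) : ⇑(G.single x) = Set.indicator {x} 1 :=
  G.eq_of_ae (MemLp.coeFn_toLp _)

theorem single_mem_Cc (x : V) : G.single x ∈ G.Cc := by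
  change (Function.support (G.single x)).Finite
  rw [coe_single]
  exact (Set.finite_singleton x).subset Set.support_indicator_subset

theorem inner_single (x : V) (f : G.L2) : inner ℂ (G.single x) f = G.m x • f x := by
  rw [G.inner_eq_sum _ f {x}]
  · simp [coe_single]
  · intro y hy
    have : y ≠ x := by simpa using hy
    simp [coe_single, this]

/-- Evaluation at `x`, as a continuous linear functional on `ℓ²(V, m)`. -/
def evalL (x : V) : G.L2 →L[ℂ] ℂ := ((G.m x)⁻¹ : ℂ) • innerSL ℂ (G.single x)

theorem evalL_apply (x : V) (f : G.L2) : G.evalL x f = f x := by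
  have : (G.m x : ℂ) ≠ 0 := Complex.ofReal_ne_zero.mpr (G.m_pos x).ne'
  change ((G.m x)⁻¹ : ℂ) • inner ℂ (G.single x) f = f x
  rw [inner_single, Complex.real_smul, smul_eq_mul, inv_mul_cancel_left₀ this]

theorem dense_Cc : Dense (G.Cc : Set G.L2) := by
  rw [Submodule.dense_iff_topologicalClosure_eq_top, Submodule.topologicalClosure_eq_top_iff,
    Submodule.eq_bot_iff]
  intro f hf
  refine Lp.ext (Eventually.of_forall fun x => ?_)
  have h := hf _ (G.single_mem_Cc x)
  rw [inner_single, smul_eq_zero] at h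
  rw [h.resolve_left (G.m_pos x).ne', G.coe_zero, Pi.zero_apply]

end Measure

end WGraph

end

/-! ### The form domain as a Hilbert space and the resolvent -/

noncomputable section

namespace WGraph

variable {V : Type*} (G : WGraph V)

/-- The Hilbert space in which the gradients take their values. -/
abbrev EdgeL2 (_ : WGraph V) : Type _ := lp (fun _ : V × V => ℂ) 2

theorem memℓp_gradFun {f : V → ℂ} (hf : (Function.support f).Finite) :
    Memℓp (E := fun _ : V × V => ℂ) (G.gradFun f) 2 := by
  obtain ⟨X, hX⟩ := G.exists_isNhdSupport hf
  suffices h : Memℓp (E := fun _ : V × V => ℂ) (G.gradFun f) 0 from h.of_exponent_ge zero_le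
  refine memℓp_zero ?_
  refine (X ×ˢ X).finite_toSet.subset fun p hp => ?_
  by_contra h
  exact hp (G.gradFun_eq_zero hX h)

variable [MeasurableSpace V] [DiscreteMeasurableSpace V]

theorem support_finite (f : G.Cc) : (Function.support (f : G.L2)).Finite := f.2

/-- The discrete gradient on `C_c(V)`. -/
def grad : G.Cc →ₗ[ℂ] G.EdgeL2 where
  toFun f := ⟨G.gradFun (f : G.L2), G.memℓp_gradFun (G.support_finite f)⟩
  map_add' f g := by
    refine Subtype.ext (funext fun p => ?_)
    change G.gradFun ((f : G.L2) + (g : G.L2) : G.L2) p = G.gradFun _ p + G.gradFun _ p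
    simp only [gradFun, coe_add, Pi.add_apply, ← smul_add]
    congr 1
    ring
  map_smul' c f := by
    refine Subtype.ext (funext fun p => ?_)
    change G.gradFun (c • (f : G.L2) : G.L2) p = c • G.gradFun _ p
    simp only [gradFun, coe_smul, Pi.smul_apply, ← smul_sub]
    rw [smul_comm]

theorem grad_apply (f : G.Cc) (p : V × V) : G.grad f p = G.gradFun (f : G.L2) p := rfl

theorem norm_grad_sq_eq_tsum (f : G.Cc) :
    HasSum (fun p => ‖G.gradFun (f : G.L2) p‖ ^ 2) (‖G.grad f‖ ^ 2) := by
  have := lp.hasSum_norm (by norm_num) (G.grad f)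
  simpa [grad_apply] using this

theorem energy_eq_norm_grad (f : G.Cc) :
    G.energy (f : G.L2) = ENNReal.ofReal (‖G.grad f‖ ^ 2) := by
  have h := G.norm_grad_sq_eq_tsum f
  rw [energy_eq_tsum, ← h.tsum_eq,
    ENNReal.ofReal_tsum_of_nonneg (fun p => by positivity) h.summable]

/-- The graph of the gradient on `C_c(V)`. -/
def gradGraph : G.Cc →ₗ[ℂ] WithLp 2 (G.L2 × G.EdgeL2) :=
  (WithLp.linearEquiv 2 ℂ (G.L2 × G.EdgeL2)).symm.toLinearMap ∘ₗ G.Cc.subtype.prod G.grad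

/-- The form domain with its Hilbert space structure: the closure of the graph of the gradient. -/
def formSpace : Submodule ℂ (WithLp 2 (G.L2 × G.EdgeL2)) := G.gradGraph.range.topologicalClosure

instance : CompleteSpace G.formSpace := by
  have : IsClosed (G.formSpace : Set (WithLp 2 (G.L2 × G.EdgeL2))) :=
    Submodule.isClosed_topologicalClosure _
  exact this.completeSpace_coe

/-- The inclusion of the form domain into `ℓ²(V, m)`. -/
def formEmbedding : G.formSpace →L[ℂ] G.L2 :=
  (WithLp.fstL 2 ℂ G.L2 G.EdgeL2).comp G.formSpace.subtypeL

theorem formEmbedding_apply (w : G.formSpace) : G.formEmbedding w = w.1.fst := rfl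

/-- The inclusion of `C_c(V)` into the form space. -/
def ofCc (f : G.Cc) : G.formSpace :=
  ⟨G.gradGraph f, Submodule.le_topologicalClosure _ ⟨f, rfl⟩⟩

theorem continuous_inner_formSpace (w : G.formSpace) :
    Continuous fun v : G.formSpace => inner ℂ w v := by
  change Continuous fun v : G.formSpace => inner ℂ w.1 v.1
  exact continuous_const.inner continuous_subtype_val

theorem exists_seq_of_mem_formSpace (w : G.formSpace) :
    ∃ u : ℕ → G.Cc, Tendsto (fun n => G.gradGraph (u n)) atTop (𝓝 w.1) := by
  have hw : (w : WithLp 2 (G.L2 × G.EdgeL2)) ∈ closure (G.gradGraph.range : Set _) := w.2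
  obtain ⟨v, hv, hlim⟩ := mem_closure_iff_seq_limit.mp hw
  choose u hu using hv
  exact ⟨u, by simpa only [hu] using hlim⟩

theorem dense_range_ofCc : DenseRange G.ofCc := by
  intro w
  obtain ⟨u, hu⟩ := G.exists_seq_of_mem_formSpace w
  refine mem_closure_of_tendsto (f := fun n => G.ofCc (u n)) (b := atTop) ?_
    (Eventually.of_forall fun n => ⟨u n, rfl⟩)
  exact tendsto_subtype_rng.mpr hu

/-- Since the edge space is complete, a sequence of `C_c(V)` converging in `ℓ²(V, m)` is Cauchy for
the energy exactly when its graph points converge. -/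
theorem mem_formDomain_iff (f : G.L2) :
    f ∈ G.formDomain ↔ ∃ w : G.formSpace, G.formEmbedding w = f := by
  have key : ∀ u : ℕ → G.Cc, (CauchySeq fun n => G.grad (u n)) ↔
      Tendsto (fun p : ℕ × ℕ => G.energy ((u p.1 : G.L2) - (u p.2 : G.L2) : G.L2)) atTop (𝓝 0) := by
    intro u
    have h : ∀ p : ℕ × ℕ, G.energy ((u p.1 : G.L2) - (u p.2 : G.L2) : G.L2)
        = ENNReal.ofReal (dist (G.grad (u p.1)) (G.grad (u p.2)) ^ 2) := by
      intro p
      rw [dist_eq_norm, ← map_sub, ← energy_eq_norm_grad]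
      rfl
    simp only [h]
    rw [cauchySeq_iff_tendsto_dist_atTop_0]
    constructor
    · intro h
      simpa using ENNReal.tendsto_ofReal (h.pow 2)
    · intro h
      have h1 := (ENNReal.tendsto_toReal ENNReal.zero_ne_top).comp h
      have h2 := (Real.continuous_sqrt.tendsto _).comp h1
      simp only [ENNReal.toReal_zero, Real.sqrt_zero] at h2
      refine h2.congr fun p => ?_
      simp only [Function.comp_apply]
      rw [ENNReal.toReal_ofReal (by positivity), Real.sqrt_sq dist_nonneg]
  constructor
  · rintro ⟨u, hu, hlim, hE⟩
    have hc : CauchySeq fun n => G.grad ⟨u n, hu n⟩ := (key _).mpr hE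
    obtain ⟨g, hg⟩ := cauchySeq_tendsto_of_complete hc
    refine ⟨⟨WithLp.toLp 2 (f, g), ?_⟩, rfl⟩
    refine mem_closure_of_tendsto (f := fun n => G.gradGraph ⟨u n, hu n⟩) (b := atTop) ?_
      (Eventually.of_forall fun n => ⟨_, rfl⟩)
    exact ((WithLp.prod_continuous_toLp 2 _ _).tendsto (f, g)).comp (hlim.prodMk_nhds hg)
  · rintro ⟨w, rfl⟩
    obtain ⟨u, hu⟩ := G.exists_seq_of_mem_formSpace w
    refine ⟨fun n => u n, fun n => (u n).2, ?_, (key u).mp ?_⟩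
    · exact ((WithLp.fstL 2 ℂ G.L2 G.EdgeL2).continuous.tendsto _).comp hu
    · exact (((WithLp.sndL 2 ℂ G.L2 G.EdgeL2).continuous.tendsto _).comp hu).cauchySeq

/-- The resolvent `(Δ_m + 1)⁻¹`. -/
def resolvent : G.L2 →L[ℂ] G.L2 :=
  G.formEmbedding.comp (ContinuousLinearMap.adjoint G.formEmbedding)

theorem resolvent_isPositive : G.resolvent.IsPositive :=
  ContinuousLinearMap.isPositive_self_comp_adjoint _

theorem resolvent_apply (h : G.L2) :
    G.resolvent h = G.formEmbedding (ContinuousLinearMap.adjoint G.formEmbedding h) := rfl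

variable [Countable V]

theorem inner_grad (u f : G.Cc) :
    inner ℂ (G.grad u) (G.grad f) = inner ℂ (u : G.L2) (G.minLaplacian f) := by
  obtain ⟨X, hX⟩ := G.exists_isNhdSupport (G.support_finite f)
  have hL : ⇑(G.minLaplacian f) = G.formalLaplacian (f : G.L2) :=
    G.eq_of_ae (MemLp.coeFn_toLp
      (G.memLp_of_finite_support (G.formalLaplacian_support (G.support_finite f))))
  obtain ⟨Y, hXY, hY⟩ : ∃ Y, X ⊆ Y ∧ ∀ x ∉ Y, (u : G.L2) x = 0 := by
    classical
    refine ⟨X ∪ (G.support_finite u).toFinset, Finset.subset_union_left, fun x hx => ?_⟩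
    by_contra h
    exact hx (Finset.mem_union_right _ (by simpa using h))
  have hY' : G.IsNhdSupport (f : G.L2) Y := fun x hx =>
    ⟨hXY (hX x hx).1, (hX x hx).2.trans hXY⟩
  rw [G.inner_eq_sum _ _ Y fun x hx => by rw [hY x hx, inner_zero_left], hL,
    ← G.sum_inner_gradFun _ _ hY', lp.inner_eq_tsum, tsum_eq_sum (s := Y ×ˢ Y)]
  · rfl
  · intro p hp
    rw [grad_apply, grad_apply, G.gradFun_eq_zero hY' hp, inner_zero_right]

/-- Green's formula on the form space. -/
theorem inner_snd_grad (w : G.formSpace) (f : G.Cc) :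
    inner ℂ w.1.snd (G.grad f) = inner ℂ w.1.fst (G.minLaplacian f) := by
  have h1 : Continuous fun w : G.formSpace => inner ℂ w.1.snd (G.grad f) :=
    (((WithLp.sndL 2 ℂ G.L2 G.EdgeL2).continuous.comp continuous_subtype_val).inner
      continuous_const)
  have h2 : Continuous fun w : G.formSpace => inner ℂ w.1.fst (G.minLaplacian f) :=
    (((WithLp.fstL 2 ℂ G.L2 G.EdgeL2).continuous.comp continuous_subtype_val).inner
      continuous_const)
  exact congrFun (G.dense_range_ofCc.equalizer h1 h2 (funext fun u => G.inner_grad u f)) w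

/-- The inner product of the form space is that of `ℓ²(V, m)` plus that of the gradients, so Green's
formula turns it into a pairing with `f + Δ̃f`. -/
theorem inner_ofCc (w : G.formSpace) (f : G.Cc) :
    inner ℂ w (G.ofCc f) = inner ℂ (G.formEmbedding w) ((f : G.L2) + G.minLaplacian f) := by
  rw [inner_add_right, formEmbedding_apply, ← inner_snd_grad]
  rfl

theorem laplacian_apply {u : G.L2} (h1 : u ∈ G.formDomain) (h2 : u ∈ G.minLaplacian.adjoint.domain) :
    G.laplacian ⟨u, ⟨h1, h2⟩⟩ = G.minLaplacian.adjoint ⟨u, h2⟩ :=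
  LinearPMap.domRestrict_apply rfl

/-- For `f` in `C_c(V)`, `⟨h, f⟩ = ⟨J* h, f⟩` in the form space, which is `⟨R h, f + Δ̃f⟩` by
`inner_ofCc`. So `h - R h` satisfies the identity that defines the adjoint at `R h`. -/
theorem laplacian_resolvent (h : G.L2) : ∃ hd : G.resolvent h ∈ G.laplacian.domain,
    G.laplacian ⟨G.resolvent h, hd⟩ + G.resolvent h = h := by
  have hf : G.resolvent h ∈ G.formDomain :=
    (G.mem_formDomain_iff _).mpr ⟨_, (G.resolvent_apply h).symm⟩
  have key : ∀ f : G.minLaplacian.domain,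
      inner ℂ (h - G.resolvent h) (f : G.L2) = inner ℂ (G.resolvent h) (G.minLaplacian f) := by
    intro f
    have h1 := G.inner_ofCc (ContinuousLinearMap.adjoint G.formEmbedding h) f
    have h2 : G.formEmbedding (G.ofCc f) = (f : G.L2) := rfl
    rw [ContinuousLinearMap.adjoint_inner_left, inner_add_right, h2, ← resolvent_apply] at h1
    rw [inner_sub_left, sub_eq_iff_eq_add']
    exact h1
  generalize G.resolvent h = u at hf key ⊢
  have hd : u ∈ G.minLaplacian.adjoint.domain :=
    LinearPMap.mem_adjoint_domain_of_exists _ ⟨_, key⟩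
  refine ⟨⟨hf, hd⟩, ?_⟩
  rw [G.laplacian_apply hf hd, LinearPMap.adjoint_apply_eq G.dense_Cc _ key, sub_add_cancel]

/-- For any `w` in the form space lying over `u`, the vectors `J* (Δ_m u + u)` and `w` have the same
inner products with the dense image of `C_c(V)`, hence coincide; then `J` is applied. -/
theorem resolvent_laplacian (u : G.laplacian.domain) :
    G.resolvent (G.laplacian u + u) = u := by
  obtain ⟨u, hu1, hu2⟩ := u
  have h2 := G.laplacian_apply hu1 hu2
  obtain ⟨w, rfl⟩ := (G.mem_formDomain_iff u).mp hu1
  have hw : ContinuousLinearMap.adjoint G.formEmbedding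
      (G.laplacian ⟨G.formEmbedding w, ⟨hu1, hu2⟩⟩ + G.formEmbedding w) = w := by
    refine ext_inner_right ℂ fun v => ?_
    refine congrFun (G.dense_range_ofCc.equalizer (g := fun v : G.formSpace => inner ℂ _ v)
      (h := fun v : G.formSpace => inner ℂ w v) (G.continuous_inner_formSpace _)
      (G.continuous_inner_formSpace w)
      (funext fun f => ?_)) v
    change inner ℂ _ (G.ofCc f) = inner ℂ w (G.ofCc f)
    rw [ContinuousLinearMap.adjoint_inner_left, inner_ofCc, inner_add_left, inner_add_right, h2,
      add_comm]
    congr 1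
    exact LinearPMap.adjoint_isFormalAdjoint G.dense_Cc ⟨_, hu2⟩ f
  exact congrArg G.formEmbedding hw

/-! ### From a supersolution to a bound on the essential spectrum -/

/-- The Hardy inequality on the form space, outside a finite set. -/
theorem norm_sq_formEmbedding_le {W : V → ℝ} (hW : ∀ x, 0 < W x) {s : ℝ} (hs : 0 ≤ s) (X : Finset V)
    (hX : ∀ x ∉ X, s * W x ≤ G.formalLaplacian W x) (h0 : ∀ x, 0 ≤ G.formalLaplacian W x)
    (w : G.formSpace) :
    (1 + s) * ‖G.formEmbedding w‖ ^ 2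
      ≤ ‖w‖ ^ 2 + s * ∑ x ∈ X, G.m x * ‖G.evalL x (G.formEmbedding w)‖ ^ 2 := by
  refine isClosed_property (p := fun w : G.formSpace => (1 + s) * ‖G.formEmbedding w‖ ^ 2
      ≤ ‖w‖ ^ 2 + s * ∑ x ∈ X, G.m x * ‖G.evalL x (G.formEmbedding w)‖ ^ 2)
    G.dense_range_ofCc (isClosed_le (by fun_prop) (by fun_prop)) (fun f => ?_) w
  simp only [evalL_apply]
  have e0 : G.formEmbedding (G.ofCc f) = (f : G.L2) := rfl
  rw [e0]
  obtain ⟨Y, hY⟩ := G.exists_isNhdSupport (G.support_finite f)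
  have e1 : ‖G.ofCc f‖ ^ 2 = ‖(f : G.L2)‖ ^ 2 + ‖G.grad f‖ ^ 2 :=
    WithLp.prod_norm_sq_eq_of_L2 (G.gradGraph f)
  have e2 : ‖(f : G.L2)‖ ^ 2 = ∑ x ∈ Y, G.m x * ‖(f : G.L2) x‖ ^ 2 := by
    have h := G.inner_eq_sum f f Y fun x hx => by rw [hY.eq_zero hx, inner_zero_left]
    rw [inner_self_eq_norm_sq_to_K] at h
    simp only [inner_self_eq_norm_sq_to_K, Complex.real_smul, Complex.coe_algebraMap] at h
    exact_mod_cast h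
  have e3 : ∑ x ∈ Y, G.m x * (‖(f : G.L2) x‖ ^ 2 * (G.formalLaplacian W x / W x))
      ≤ ‖G.grad f‖ ^ 2 :=
    (G.sum_le_sum_norm_gradFun _ hY hW).trans
      (sum_le_hasSum _ (fun p _ => by positivity) (G.norm_grad_sq_eq_tsum f))
  -- Off `X` the ratio `Δ̃W / W` is at least `s`; on `X` it is only non-negative, and the last sum
  -- makes up the difference.
  have e4 : s * ∑ x ∈ Y, G.m x * ‖(f : G.L2) x‖ ^ 2
      ≤ ∑ x ∈ Y, G.m x * (‖(f : G.L2) x‖ ^ 2 * (G.formalLaplacian W x / W x))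
        + s * ∑ x ∈ X, G.m x * ‖(f : G.L2) x‖ ^ 2 := by
    classical
    have hm : ∀ x, 0 ≤ G.m x * ‖(f : G.L2) x‖ ^ 2 := fun x => by
      have := G.m_pos x
      positivity
    calc s * ∑ x ∈ Y, G.m x * ‖(f : G.L2) x‖ ^ 2
        ≤ ∑ x ∈ Y, (G.m x * (‖(f : G.L2) x‖ ^ 2 * (G.formalLaplacian W x / W x))
          + s * if x ∈ X then G.m x * ‖(f : G.L2) x‖ ^ 2 else 0) := by
          rw [Finset.mul_sum]
          refine Finset.sum_le_sum fun x _ => ?_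
          rw [← mul_assoc (G.m x)]
          split_ifs with hx
          · have := mul_nonneg (hm x) (div_nonneg (h0 x) (hW x).le)
            linarith
          · rw [mul_zero, add_zero, mul_comm]
            exact mul_le_mul_of_nonneg_left ((le_div_iff₀ (hW x)).mpr (hX x hx)) (hm x)
      _ ≤ _ := by
          rw [Finset.sum_add_distrib, ← Finset.mul_sum, ← Finset.sum_filter]
          refine add_le_add_right (mul_le_mul_of_nonneg_left ?_ hs) _
          exact Finset.sum_le_sum_of_subset_of_nonneg (fun x hx => (Finset.mem_filter.mp hx).2)
            fun x _ _ => hm x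
  rw [e1, add_mul, one_mul]
  nth_rewrite 2 [e2]
  linarith

/-- Let `w = J* h`. Then `‖w‖² = ⟨h, R h⟩ ≤ ‖h‖ ‖R h‖`, while the Hardy inequality loses its sum
over `X` and reads `(1 + s) ‖R h‖² ≤ ‖w‖²`. -/
theorem resolvent_norm_le {W : V → ℝ} (hW : ∀ x, 0 < W x) {s : ℝ} (hs : 0 ≤ s) (X : Finset V)
    (hX : ∀ x ∉ X, s * W x ≤ G.formalLaplacian W x) (h0 : ∀ x, 0 ≤ G.formalLaplacian W x)
    {h : G.L2} (hh : ∀ x ∈ X, G.evalL x (G.resolvent h) = 0) :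
    (1 + s) * ‖G.resolvent h‖ ≤ ‖h‖ := by
  set w := ContinuousLinearMap.adjoint G.formEmbedding h with hw
  have h1 := G.norm_sq_formEmbedding_le hW hs X hX h0 w
  have hRh : G.formEmbedding w = G.resolvent h := rfl
  rw [hRh, Finset.sum_eq_zero fun x hx => by rw [hh x hx]; simp, mul_zero, add_zero] at h1
  have h2 : ‖w‖ ^ 2 ≤ ‖h‖ * ‖G.resolvent h‖ := by
    have h3 : inner ℂ w w = inner ℂ h (G.resolvent h) := by
      rw [← hRh]
      nth_rewrite 1 [hw]
      rw [ContinuousLinearMap.adjoint_inner_left]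
    rw [← inner_self_eq_norm_sq (𝕜 := ℂ), h3]
    exact re_inner_le_norm _ _
  by_cases h0 : G.resolvent h = 0
  · rw [h0]
    simp
  · have hp : 0 < ‖G.resolvent h‖ := norm_pos_iff.mpr h0
    refine le_of_mul_le_mul_right ?_ hp
    calc (1 + s) * ‖G.resolvent h‖ * ‖G.resolvent h‖ = (1 + s) * ‖G.resolvent h‖ ^ 2 := by ring
      _ ≤ _ := h1.trans h2

/-- A positive function `W` with `Δ̃ W ≥ 0` everywhere and `Δ̃ W ≥ s W` outside a finite set bounds
the essential spectrum from below by `s`. -/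
theorem mem_essentialSpectrum_of_supersolution {W : V → ℝ} (hW : ∀ x, 0 < W x) {s : ℝ} (hs : 0 < s)
    (X : Finset V) (hX : ∀ x ∉ X, s * W x ≤ G.formalLaplacian W x)
    (h0 : ∀ x, 0 ≤ G.formalLaplacian W x) {z : ℂ} (hz : z ∈ essentialSpectrum G.laplacian) :
    ∃ t : ℝ, z = t ∧ s ≤ t := by
  -- The finite-rank map records the values on `X` of `R h`, not of `h`.
  refine mem_essentialSpectrum_of_resolvent G.resolvent_isPositive G.laplacian_resolvent
    G.resolvent_laplacian hs
    (ContinuousLinearMap.pi fun x : X => (G.evalL x).comp G.resolvent) (fun h hh => ?_) hz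
  exact G.resolvent_norm_le hW hs.le X hX h0 fun x hx => congrFun hh ⟨x, hx⟩

end WGraph

end

/-! ### The exponential supersolution of a 1-dimensional decomposition -/

noncomputable section

namespace OneDimDecomposition

variable {V : Type*} {G : WGraph V} (S : OneDimDecomposition G)

/-- The supersolution `c ^ (-max(|x|, n))`. -/
def expWeight (c : ℝ) (n : ℕ) (x : V) : ℝ := (c ^ max (S.level x) n)⁻¹

theorem expWeight_pos {c : ℝ} (hc : 0 < c) (n : ℕ) (x : V) : 0 < S.expWeight c n x := by
  rw [expWeight]
  positivity

/-- The weight attains its maximum on the ball, so every difference is non-negative. -/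
theorem formalLaplacian_expWeight_nonneg {c : ℝ} (hc : 1 < c) {n : ℕ} {x : V}
    (hx : S.level x ≤ n) : 0 ≤ G.formalLaplacian (S.expWeight c n) x := by
  rw [WGraph.formalLaplacian, smul_eq_mul]
  refine mul_nonneg (inv_nonneg.mpr (G.m_pos x).le) (Finset.sum_nonneg fun y _ => ?_)
  refine mul_nonneg (G.E_nonneg x y) (sub_nonneg.mpr ?_)
  rw [expWeight, expWeight, max_eq_right hx]
  have := hc.le
  gcongr
  exact le_max_right _ _

/-- An outward edge contributes `(1 - 1/c) W(x)`, an inward edge `(1 - c) W(x)`, a level edge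
nothing. As `n < |x|`, inner neighbours still have level at least `n`, so the truncation is not
felt. -/
theorem formalLaplacian_expWeight {c : ℝ} (hc : 1 < c) {n : ℕ} {x : V} (hx : n < S.level x) :
    G.formalLaplacian (S.expWeight c n) x
      = (c - 1) / c * (S.degPlus x - c * S.degMinus x) * S.expWeight c n x := by
  have hc0 : c ≠ 0 := by positivity
  have hterm : ∀ y ∈ G.nbrs x, G.E x y • (S.expWeight c n x - S.expWeight c n y)
      = (c - 1) / c * S.expWeight c n x * (if S.level y = S.level x + 1 then G.E x y else 0)
        - (c - 1) * S.expWeight c n x * (if S.level y + 1 = S.level x then G.E x y else 0) := by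
    intro y hy
    have hl := S.level_le x y (G.mem_nbrs.mp hy)
    rw [smul_eq_mul]
    rcases lt_trichotomy (S.level y) (S.level x) with h | h | h
    · have h1 : S.level y + 1 = S.level x := by omega
      have h2 : S.level y ≠ S.level x + 1 := by omega
      rw [if_pos h1, if_neg h2, expWeight, expWeight, ← h1, max_eq_left (by omega),
        max_eq_left (by omega)]
      field_simp
      ring
    · have h1 : S.level y + 1 ≠ S.level x := by omega
      have h2 : S.level y ≠ S.level x + 1 := by omega
      rw [if_neg h1, if_neg h2, expWeight, expWeight, h]
      ring
    · have h1 : S.level y + 1 ≠ S.level x := by omega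
      have h2 : S.level y = S.level x + 1 := by omega
      rw [if_neg h1, if_pos h2, expWeight, expWeight, h2, max_eq_left (by omega),
        max_eq_left (by omega)]
      field_simp
      ring
  rw [WGraph.formalLaplacian, Finset.sum_congr rfl hterm, Finset.sum_sub_distrib, ← Finset.mul_sum,
    ← Finset.mul_sum, ← Finset.sum_filter, ← Finset.sum_filter, smul_eq_mul, degPlus, degMinus]
  have := (G.m_pos x).ne'
  field_simp

theorem ball_finite (N : ℕ) : (S.ball N).Finite := by
  refine ((Set.finite_Iic N).biUnion fun n _ => S.sphere_finite n).subset fun x hx => ?_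
  exact Set.mem_biUnion (x := S.level x) hx rfl

theorem exists_forall_lt_of_lt_lowerLimit {c r : ℝ} (h : (r : EReal) < S.lowerLimit c) :
    ∃ N, ∀ x, N ≤ S.level x → r < S.degPlus x - c * S.degMinus x := by
  have h1 := eventually_lt_of_lt_liminf h
  rw [atInfinity, eventually_comap, eventually_atTop] at h1
  obtain ⟨N, hN⟩ := h1
  exact ⟨N, fun x hx => EReal.coe_lt_coe_iff.mp (hN _ hx x rfl)⟩

theorem nonneg_of_radius_le {c : ℝ} (hl : 0 < S.lowerLimit c) {x : V}
    (hx : S.radius c ≤ S.level x) : 0 ≤ S.degPlus x - c * S.degMinus x := by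
  -- Nonemptiness rules out the default value `sInf ∅ = 0`.
  have hne : {n : ℕ | ∀ x, n ≤ S.level x → 0 ≤ S.degPlus x - c * S.degMinus x}.Nonempty := by
    obtain ⟨N, hN⟩ := S.exists_forall_lt_of_lt_lowerLimit (r := 0) (by simpa using hl)
    exact ⟨N, fun x hx => (hN x hx).le⟩
  exact Nat.sInf_mem hne x hx

theorem potential_nonneg {c : ℝ} (hc : 1 < c) (hl : 0 < S.lowerLimit c) (x : V) :
    0 ≤ S.potential c x := by
  refine Set.indicator_nonneg (fun x hx => ?_) x
  have h1 : S.radius c < S.level x := not_le.mp hx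
  exact mul_nonneg (div_nonneg (by linarith) (by linarith)) (S.nonneg_of_radius_le hl h1.le)

theorem potential_mul_expWeight_le {c : ℝ} (hc : 1 < c) (x : V) :
    S.potential c x * S.expWeight c (S.radius c) x
      ≤ G.formalLaplacian (S.expWeight c (S.radius c)) x := by
  by_cases hx : x ∈ S.ball (S.radius c)
  · rw [potential, Set.indicator_of_notMem (Set.notMem_compl_iff.mpr hx), zero_mul]
    exact S.formalLaplacian_expWeight_nonneg hc hx
  · rw [potential, Set.indicator_of_mem hx, S.formalLaplacian_expWeight hc (not_le.mp hx)]

theorem mem_essentialSpectrum_laplacian [Countable V] [MeasurableSpace V]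
    [DiscreteMeasurableSpace V] {c : ℝ} (hc : 1 < c) (hl : 0 < S.lowerLimit c) {r : ℝ} (hr : 0 < r)
    (hrl : (r : EReal) < S.lowerLimit c) {z : ℂ} (hz : z ∈ essentialSpectrum G.laplacian) :
    ∃ t : ℝ, z = t ∧ (c - 1) / c * r ≤ t := by
  have hc0 : 0 < c := by positivity
  have ha : 0 < (c - 1) / c := div_pos (by linarith) hc0
  obtain ⟨N, hN⟩ := S.exists_forall_lt_of_lt_lowerLimit hrl
  -- Beyond level `N` the degree difference exceeds `r`; beyond the radius the formula for `Δ̃W`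
  -- holds. The exceptional ball must cover both.
  refine G.mem_essentialSpectrum_of_supersolution (S.expWeight_pos hc0 (S.radius c))
    (mul_pos ha hr) (S.ball_finite (max N (S.radius c))).toFinset (fun x hx => ?_) (fun x => ?_) hz
  · have hx' : max N (S.radius c) < S.level x := by
      simpa [ball] using hx
    rw [S.formalLaplacian_expWeight hc ((le_max_right _ _).trans_lt hx')]
    have h1 := (hN x ((le_max_left _ _).trans hx'.le)).le
    have h2 := (S.expWeight_pos hc0 (S.radius c) x).le
    gcongr
  · exact (mul_nonneg (S.potential_nonneg hc hl x) (S.expWeight_pos hc0 _ x).le).trans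
      (S.potential_mul_expWeight_le hc x)

end OneDimDecomposition

end

theorem theoremt {V : Type*} [Countable V] [MeasurableSpace V] [DiscreteMeasurableSpace V]
    (G : WGraph V) (S : OneDimDecomposition G) (c : ℝ) (hc : 1 < c)
    (hl : 0 < S.lowerLimit c) :
    (∀ x, 0 ≤ S.potential c x) ∧
    (∃ W : V → ℝ,
      (∀ x, 0 < W x) ∧
      (∀ x ∈ S.ball (S.radius c), W x = (c ^ S.radius c)⁻¹) ∧
      (∀ x ∉ S.ball (S.radius c), W x = (c ^ S.level x)⁻¹) ∧
      ∀ x, S.potential c x * W x ≤ G.formalLaplacian W x) ∧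
    (∀ z ∈ essentialSpectrum G.laplacian,
      ∃ t : ℝ, z = t ∧ S.lowerLimit c * (((c - 1) / c : ℝ) : EReal) ≤ t) ∧
    (S.lowerLimit c = ⊤ → essentialSpectrum G.laplacian = ∅) := by
  have hc0 : 0 < c := by positivity
  have ha : 0 < (c - 1) / c := div_pos (by linarith) hc0
  have hess : ∀ z ∈ essentialSpectrum G.laplacian,
      ∃ t : ℝ, z = t ∧ S.lowerLimit c * (((c - 1) / c : ℝ) : EReal) ≤ t := by
    intro z hz
    -- Any admissible `r₀` serves to show that `z` is real.
    obtain ⟨r₀, hr₀, hr₀l⟩ := EReal.lt_iff_exists_real_btwn.mp hl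
    obtain ⟨t, rfl, -⟩ := S.mem_essentialSpectrum_laplacian hc hl (EReal.coe_pos.mp hr₀) hr₀l hz
    refine ⟨t, rfl, ?_⟩
    rw [← EReal.le_div_iff_mul_le (EReal.coe_pos.mpr ha) (EReal.coe_ne_top _), ← EReal.coe_div]
    by_contra! hlt
    -- The maximum with `0` keeps `r` positive, as the spectral bound requires.
    obtain ⟨r, hr, hrl⟩ := EReal.lt_iff_exists_real_btwn.mp (max_lt hl hlt)
    obtain ⟨t', ht', hle⟩ := S.mem_essentialSpectrum_laplacian hc hl
      (EReal.coe_pos.mp ((le_max_left _ _).trans_lt hr)) hrl hz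
    have h1 : t / ((c - 1) / c) < r := EReal.coe_lt_coe_iff.mp ((le_max_right _ _).trans_lt hr)
    rw [div_lt_iff₀' ha] at h1
    have h2 : t = t' := Complex.ofReal_injective ht'
    linarith
  refine ⟨S.potential_nonneg hc hl, ⟨S.expWeight c (S.radius c), S.expWeight_pos hc0 _,
    fun x hx => ?_, fun x hx => ?_, S.potential_mul_expWeight_le hc⟩, hess, fun htop => ?_⟩
  · rw [OneDimDecomposition.expWeight, max_eq_right hx]
  · rw [OneDimDecomposition.expWeight, max_eq_left (not_le.mp hx).le]
  · refine Set.eq_empty_of_forall_notMem fun z hz => ?_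
    obtain ⟨t, -, ht⟩ := hess z hz
    rw [htop, EReal.top_mul_of_pos (EReal.coe_pos.mpr ha), top_le_iff] at ht
    exact EReal.coe_ne_top t ht
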